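/- Consider two bosonic modes $A$ and $B$ with Fock bases $|m\rangle_A$, $|k\rangle_B$ and annihilation operators $a$, $b$, and let $n = a^\dagger a$. For real $\kappa,\phi,\theta$ put $$U_A = e^{i\phi a^\dagger a},\qquad U_B = e^{i\theta b^\dagger b},\qquad U_{AB} = \exp\!\big[i\kappa(a^\dagger b + a b^\dagger)\big],\qquad \eta = \cos^2\kappa,$$ and, for a unit vector $|\psi\rangle$ of mode $A$, let $|\Psi\rangle = |\psi\rangle_A\otimes|0\rangle_B$ and $$F = \big|\langle\Psi|U_{AB}^\dagger U_B^\dagger U_A U_{AB}|\Psi\rangle\big|^2 .$$ Assume that one of the following conditions holds: (I) $\eta < \tfrac12$; or (II) $\eta\ge\tfrac12$, $|\sin\phi|\le (1-\eta)/\eta$ and $\cos\phi>0$. Then there is a real $\theta$ for which $$z = \eta e^{i\phi} + (1-\eta)e^{-i\theta}$$ is real and positive, and for every such $\theta$ and every unit vector $|\psi\rangle$ with finite mean photon number $\langle n\rangle = \sum_{m} m\,|\langle m|\psi\rangle|^2$, $$F \ge F_z := z^{2\langle n\rangle}.$$ -/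

import Mathlib

noncomputable section

namespace LossyPhase

/-- The Hilbert space of one optical mode, in the photon-number (Fock) basis: `ψ n` is the
amplitude of the state with `n` photons. -/
abbrev Mode : Type := lp (fun _ : ℕ => ℂ) 2

/-- The Hilbert space of the two modes `A` and `B`, in the product Fock basis: the amplitude at
`(m, k)` belongs to `m` photons in `A` and `k` photons in `B`. -/
abbrev TwoMode : Type := lp (fun _ : ℕ × ℕ => ℂ) 2

/-- Finite linear combinations of the product Fock states, the common invariant domain on which
the (unbounded) ladder operators are given. -/
abbrev FockCore : Type := ℕ × ℕ →₀ ℂ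

/-- The inclusion of the finite linear combinations into the two-mode Hilbert space. -/
def toTwoMode : FockCore →ₗ[ℂ] TwoMode :=
  Finsupp.linearCombination ℂ (fun p : ℕ × ℕ => (lp.single 2 p (1 : ℂ) : TwoMode))

/-- The annihilation operator `a` of mode `A`: `a |m, k⟩ = √m |m - 1, k⟩`
(which is zero for `m = 0`). -/
def annihA : FockCore →ₗ[ℂ] FockCore :=
  Finsupp.linearCombination ℂ
    (fun p : ℕ × ℕ => Finsupp.single (p.1 - 1, p.2) ((Real.sqrt (p.1 : ℝ) : ℝ) : ℂ))

/-- The creation operator `a†` of mode `A`: `a† |m, k⟩ = √(m + 1) |m + 1, k⟩`. -/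
def creatA : FockCore →ₗ[ℂ] FockCore :=
  Finsupp.linearCombination ℂ
    (fun p : ℕ × ℕ => Finsupp.single (p.1 + 1, p.2) ((Real.sqrt ((p.1 : ℝ) + 1) : ℝ) : ℂ))

/-- The annihilation operator `b` of mode `B`: `b |m, k⟩ = √k |m, k - 1⟩`
(which is zero for `k = 0`). -/
def annihB : FockCore →ₗ[ℂ] FockCore :=
  Finsupp.linearCombination ℂ
    (fun p : ℕ × ℕ => Finsupp.single (p.1, p.2 - 1) ((Real.sqrt (p.2 : ℝ) : ℝ) : ℂ))

/-- The creation operator `b†` of mode `B`: `b† |m, k⟩ = √(k + 1) |m, k + 1⟩`. -/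
def creatB : FockCore →ₗ[ℂ] FockCore :=
  Finsupp.linearCombination ℂ
    (fun p : ℕ × ℕ => Finsupp.single (p.1, p.2 + 1) ((Real.sqrt ((p.2 : ℝ) + 1) : ℝ) : ℂ))

/-- `T` is the exponential of the operator `X`: on every finite linear combination `v` of Fock
states, `T v = ∑ Xʲ v / j!`, the series converging in the norm of the Hilbert space. -/
def IsOpExp (X : FockCore →ₗ[ℂ] FockCore) (T : TwoMode →L[ℂ] TwoMode) : Prop :=
  ∀ v : FockCore, HasSum (fun j : ℕ => ((Nat.factorial j : ℂ)⁻¹) • toTwoMode ((X ^ j) v)) (T (toTwoMode v))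

/-- A bounded operator is determined by being the exponential of `X`. -/
theorem IsOpExp.unique {X : FockCore →ₗ[ℂ] FockCore} {S T : TwoMode →L[ℂ] TwoMode}
    (hS : IsOpExp X S) (hT : IsOpExp X T) : S = T := by
  refine ContinuousLinearMap.ext fun f => ?_
  have key : ∀ p : ℕ × ℕ, ∀ c : ℂ,
      S (lp.single 2 p c : TwoMode) = T (lp.single 2 p c : TwoMode) := by
    intro p c
    have h := (hS (Finsupp.single p c)).unique (hT (Finsupp.single p c))
    have e : toTwoMode (Finsupp.single p c) = (lp.single 2 p c : TwoMode) := by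
      rw [toTwoMode, Finsupp.linearCombination_single, ← lp.single_smul, smul_eq_mul, mul_one]
    rwa [e] at h
  have hf : HasSum (fun p : ℕ × ℕ => (lp.single 2 p (f p) : TwoMode)) f :=
    lp.hasSum_single (by norm_num) f
  have h1 := S.hasSum hf
  have h2 := T.hasSum hf
  simp only [key] at h1
  exact h1.unique h2

open Classical in
/-- The exponential of an operator `X` as a bounded operator on the two-mode Hilbert space
(zero if the exponential is not bounded). -/
def opExp (X : FockCore →ₗ[ℂ] FockCore) : TwoMode →L[ℂ] TwoMode :=
  if h : ∃ T : TwoMode →L[ℂ] TwoMode, IsOpExp X T then h.choose else 0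

/-- The phase modulation `U_A = exp(i φ a†a)`. -/
def UA (φ : ℝ) : TwoMode →L[ℂ] TwoMode :=
  opExp ((Complex.I * (φ : ℂ)) • (creatA ∘ₗ annihA))

/-- The auxiliary phase shift `U_B = exp(i θ b†b)` of the inaccessible mode. -/
def UB (θ : ℝ) : TwoMode →L[ℂ] TwoMode :=
  opExp ((Complex.I * (θ : ℂ)) • (creatB ∘ₗ annihB))

/-- The beam splitter `U_AB = exp[i κ (a†b + a b†)]` that models the loss. -/
def UAB (κ : ℝ) : TwoMode →L[ℂ] TwoMode :=
  opExp ((Complex.I * (κ : ℂ)) • (creatA ∘ₗ annihB + annihA ∘ₗ creatB))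

/-- The vector `|ψ⟩_A ⊗ |0⟩_B`: its amplitude at `(m, 0)` is `ψ m`, all others vanish. -/
def withVacuum (ψ : Mode) : TwoMode :=
  ⟨fun p => if p.2 = 0 then ψ p.1 else 0, by
    have hψ : Memℓp (fun n : ℕ => ψ n) 2 := lp.memℓp ψ
    change Memℓp (fun p : ℕ × ℕ => if p.2 = 0 then ψ p.1 else 0) 2
    rw [memℓp_gen_iff (by norm_num)] at hψ ⊢
    have hinj : Function.Injective (fun n : ℕ => ((n, 0) : ℕ × ℕ)) := fun m n h => by
      simpa using h
    refine (hinj.summable_iff ?_).mp ?_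
    · rintro ⟨m, k⟩ hmk
      have hk : k ≠ 0 := fun hk => hmk ⟨m, by simp [hk]⟩
      simp [hk]
    · simpa [Function.comp_def] using hψ⟩

/-- The quantum efficiency `η = cos² κ`. -/
def efficiency (κ : ℝ) : ℝ := Real.cos κ ^ 2

/-- The complex number `η e^{iφ} + (1 - η) e^{-iθ}`. -/
def zParam (η φ θ : ℝ) : ℂ :=
  (η : ℂ) * Complex.exp (Complex.I * (φ : ℂ)) +
    (1 - (η : ℂ)) * Complex.exp (-(Complex.I * (θ : ℂ)))

/-- The fidelity `F = |⟨Ψ| U_AB† U_B† U_A U_AB |Ψ⟩|²` with `|Ψ⟩ = |ψ⟩_A ⊗ |0⟩_B`. -/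
def fidelity (κ φ θ : ℝ) (ψ : Mode) : ℝ :=
  ‖inner ℂ (withVacuum ψ)
    (ContinuousLinearMap.adjoint (UAB κ)
      (ContinuousLinearMap.adjoint (UB θ) (UA φ (UAB κ (withVacuum ψ)))))‖ ^ 2

/-- The state `ψ` has a finite mean photon number. -/
def HasFiniteMean (ψ : Mode) : Prop := Summable (fun n : ℕ => (n : ℝ) * ‖ψ n‖ ^ 2)

/-- The mean photon number `⟨n⟩ = ⟨ψ| a†a |ψ⟩ = ∑ n |ψ n|²`. -/
def meanPhoton (ψ : Mode) : ℝ := ∑' n : ℕ, (n : ℝ) * ‖ψ n‖ ^ 2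

end LossyPhase

end

namespace LossyPhase

/-! The beam splitter distributes the photons of `|l, 0⟩` binomially: `k` stay in `A` with
probability `C(l,k) ηᵏ (1-η)^(l-k)`. The phase shifts weight this term by `e^{iφk} e^{-iθ(l-k)}`,
and total photon number is conserved, so by the binomial theorem the matrix element between `|m, 0⟩`
and `|l, 0⟩` is `δ zˡ` (`inner_echo_single_zero`). The fidelity amplitude is thus `∑ zᵐ |ψ m|²`, and
Jensen's inequality for `x ↦ zˣ` bounds it below by `z^⟨n⟩`.

The exponentials must first be computed. A symmetric operator whose eigenvectors with real
eigenvalues span the core has an isometric exponential (`exists_isOpExp`). For the beam splitter,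
the polynomial model turns the generator into the derivation `x ∂/∂y + y ∂/∂x`, diagonal on `(x+y)ⁱ
(x-y)ʲ`, and its exponential into a linear change of variables (`UAB_ofPoly`). -/

/-! ### The core inside the two-mode space -/

theorem toTwoMode_single (p : ℕ × ℕ) (c : ℂ) :
    toTwoMode (Finsupp.single p c) = (lp.single 2 p c : TwoMode) := by
  rw [toTwoMode, Finsupp.linearCombination_single, ← lp.single_smul, smul_eq_mul, mul_one]

theorem toTwoMode_apply (v : FockCore) (p : ℕ × ℕ) : toTwoMode v p = v p := by
  induction v using Finsupp.induction_linear with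
  | zero => simp
  | add v w hv hw => simp [hv, hw]
  | single q c =>
    rw [toTwoMode_single, lp.single_apply]
    simp [Pi.single_apply, Finsupp.single_apply, eq_comm]

theorem denseRange_toTwoMode : DenseRange toTwoMode := by
  intro f
  have hf : HasSum (fun p : ℕ × ℕ => (lp.single 2 p (f p) : TwoMode)) f :=
    lp.hasSum_single (by norm_num) f
  refine mem_closure_of_tendsto hf (Filter.Eventually.of_forall fun s => ?_)
  refine ⟨∑ p ∈ s, Finsupp.single p (f p), ?_⟩
  simp [map_sum, toTwoMode_single]

theorem inner_toTwoMode_single_left (p : ℕ × ℕ) (c : ℂ) (f : TwoMode) :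
    inner ℂ (toTwoMode (Finsupp.single p c)) f = (starRingEnd ℂ) c * f p := by
  rw [toTwoMode_single, lp.inner_single_left]
  simp [mul_comm]

/-- Two operators on the core are formally adjoint if they are so on Fock states. -/
theorem inner_toTwoMode_eq_of_single {X Y : FockCore →ₗ[ℂ] FockCore}
    (h : ∀ p q : ℕ × ℕ, (starRingEnd ℂ) (X (Finsupp.single p 1) q) = Y (Finsupp.single q 1) p)
    (v w : FockCore) :
    inner ℂ (toTwoMode (X v)) (toTwoMode w) = inner ℂ (toTwoMode v) (toTwoMode (Y w)) := by
  induction v using Finsupp.induction_linear with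
  | zero => simp
  | add v₁ v₂ h₁ h₂ => simp [h₁, h₂]
  | single p c =>
    induction w using Finsupp.induction_linear with
    | zero => simp
    | add v₁ v₂ h₁ h₂ => simp [h₁, h₂]
    | single q d =>
      rw [inner_toTwoMode_single_left, toTwoMode_apply,
        ← inner_conj_symm, inner_toTwoMode_single_left, toTwoMode_apply]
      have e (p : ℕ × ℕ) (c : ℂ) : Finsupp.single p c = c • Finsupp.single p (1 : ℂ) := by simp
      rw [e p c, e q d, map_smul, map_smul, Finsupp.smul_apply, Finsupp.smul_apply, ← h p q]
      simp only [smul_eq_mul, map_mul, Complex.conj_conj]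
      ring

/-! ### Exponentials of symmetric operators with enough eigenvectors -/

theorem hasSum_exp_eigenvector {H : FockCore →ₗ[ℂ] FockCore} {v : FockCore} {μ : ℂ}
    (hv : H v = μ • v) (c : ℂ) :
    HasSum (fun j : ℕ => ((Nat.factorial j : ℂ)⁻¹) • toTwoMode (((c • H) ^ j) v))
      (Complex.exp (c * μ) • toTwoMode v) := by
  have hpow (j : ℕ) : ((c • H) ^ j) v = (c * μ) ^ j • v := by
    induction j with
    | zero => simp
    | succ j ih =>
      rw [pow_succ', Module.End.mul_apply, ih, map_smul, LinearMap.smul_apply, hv, smul_smul,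
        smul_smul, pow_succ, mul_assoc]
  have h := (NormedSpace.expSeries_div_hasSum_exp (c * μ)).smul_const (toTwoMode v)
  rw [← Complex.exp_eq_exp_ℂ] at h
  refine h.congr_fun ?_
  intro j
  rw [hpow, map_smul, smul_smul, div_eq_inv_mul]

/-- A symmetric operator on the core that is spanned by its eigenvectors generates a bounded
one-parameter group. -/
theorem exists_isOpExp {H : FockCore →ₗ[ℂ] FockCore}
    (hsymm : ∀ v w, inner ℂ (toTwoMode (H v)) (toTwoMode w) =
      inner ℂ (toTwoMode v) (toTwoMode (H w)))
    (hspan : Submodule.span ℂ {v | ∃ μ : ℝ, H v = (μ : ℂ) • v} = ⊤) (t : ℝ) :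
    ∃ T, IsOpExp ((Complex.I * (t : ℂ)) • H) T := by
  set X := (Complex.I * (t : ℂ)) • H with hX
  have hconv (v : FockCore) :
      ∃ s, HasSum (fun j : ℕ => ((Nat.factorial j : ℂ)⁻¹) • toTwoMode ((X ^ j) v)) s := by
    have hv : v ∈ Submodule.span ℂ {v | ∃ μ : ℝ, H v = (μ : ℂ) • v} := hspan ▸ Submodule.mem_top
    induction hv using Submodule.span_induction with
    | mem v hv => exact ⟨_, hasSum_exp_eigenvector hv.choose_spec _⟩
    | zero => exact ⟨0, by simp⟩
    | add v w _ _ hv hw =>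
      exact ⟨_, by simpa only [map_add, smul_add] using hv.choose_spec.add hw.choose_spec⟩
    | smul a v _ hv =>
      refine ⟨a • hv.choose, ?_⟩
      simpa only [map_smul, smul_comm a] using hv.choose_spec.const_smul a
  choose E hE using hconv
  let E' : FockCore →ₗ[ℂ] TwoMode :=
    { toFun := E
      map_add' := fun v w => (hE (v + w)).unique
        (by simpa only [map_add, smul_add] using (hE v).add (hE w))
      map_smul' := fun a v => (hE (a • v)).unique
        (by simpa only [map_smul, smul_comm a, RingHom.id_apply] using (hE v).const_smul a) }
  have hinner (v w : FockCore) :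
      inner ℂ (E' v) (E' w) = inner ℂ (toTwoMode v) (toTwoMode w) := by
    have hv : v ∈ Submodule.span ℂ {v | ∃ μ : ℝ, H v = (μ : ℂ) • v} := hspan ▸ Submodule.mem_top
    have hw : w ∈ Submodule.span ℂ {v | ∃ μ : ℝ, H v = (μ : ℂ) • v} := hspan ▸ Submodule.mem_top
    induction hv, hw using Submodule.span_induction₂ with
    | mem_mem v w hv hw =>
      obtain ⟨μ, hv⟩ := hv
      obtain ⟨ν, hw⟩ := hw
      have e₁ : E' v = _ := (hE v).unique (hasSum_exp_eigenvector hv _)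
      have e₂ : E' w = _ := (hE w).unique (hasSum_exp_eigenvector hw _)
      have hs := hsymm v w
      rw [hv, hw, map_smul, map_smul, inner_smul_left, inner_smul_right, Complex.conj_ofReal] at hs
      rw [e₁, e₂, inner_smul_left, inner_smul_right]
      -- For equal eigenvalues the phases cancel; for distinct ones symmetry makes the eigenvectors
      -- orthogonal.
      rcases eq_or_ne μ ν with rfl | hne
      · rw [← mul_assoc, ← Complex.exp_conj, ← Complex.exp_add]
        simp
      · have : inner ℂ (toTwoMode v) (toTwoMode w) = 0 := by
          have h0 : ((μ : ℂ) - ν) * inner ℂ (toTwoMode v) (toTwoMode w) = 0 := by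
            rw [sub_mul, hs, sub_self]
          refine (mul_eq_zero.mp h0).resolve_left ?_
          exact fun h => hne (by exact_mod_cast sub_eq_zero.mp h)
        simp [this]
    | zero_left => simp
    | zero_right => simp
    | add_left _ _ _ _ _ _ h₁ h₂ => simp only [map_add, inner_add_left, h₁, h₂]
    | add_right _ _ _ _ _ _ h₁ h₂ => simp only [map_add, inner_add_right, h₁, h₂]
    | smul_left _ _ _ _ _ h => simp only [map_smul, inner_smul_left, h]
    | smul_right _ _ _ _ _ h => simp only [map_smul, inner_smul_right, h]
  have hnorm (v : FockCore) : ‖E' v‖ ≤ 1 * ‖toTwoMode v‖ := by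
    rw [one_mul, @norm_eq_sqrt_re_inner ℂ, hinner, ← norm_eq_sqrt_re_inner]
  refine ⟨E'.extendOfNorm toTwoMode, fun v => ?_⟩
  rw [LinearMap.extendOfNorm_eq denseRange_toTwoMode ⟨1, hnorm⟩]
  exact hE v

/-- Existence rules out the default value `0` of `opExp`; uniqueness of sums then fixes its value.
-/
theorem opExp_apply_eigenvector {H : FockCore →ₗ[ℂ] FockCore}
    (hsymm : ∀ v w, inner ℂ (toTwoMode (H v)) (toTwoMode w) =
      inner ℂ (toTwoMode v) (toTwoMode (H w)))
    (hspan : Submodule.span ℂ {v | ∃ μ : ℝ, H v = (μ : ℂ) • v} = ⊤) (t : ℝ)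
    {v : FockCore} {μ : ℂ} (hv : H v = μ • v) :
    opExp ((Complex.I * (t : ℂ)) • H) (toTwoMode v) =
      Complex.exp (Complex.I * t * μ) • toTwoMode v := by
  have h := exists_isOpExp hsymm hspan t
  rw [opExp, dif_pos h]
  exact (h.choose_spec v).unique (hasSum_exp_eigenvector hv _)

/-! ### Ladder operators and phase shifts -/

theorem annihA_single (m k : ℕ) (c : ℂ) :
    annihA (Finsupp.single (m, k) c) = Finsupp.single (m - 1, k) (c * (Real.sqrt m : ℝ)) := by
  simp [annihA, Finsupp.linearCombination_single]

theorem creatA_single (m k : ℕ) (c : ℂ) :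
    creatA (Finsupp.single (m, k) c) =
      Finsupp.single (m + 1, k) (c * (Real.sqrt ((m : ℝ) + 1) : ℝ)) := by
  simp [creatA, Finsupp.linearCombination_single]

theorem annihB_single (m k : ℕ) (c : ℂ) :
    annihB (Finsupp.single (m, k) c) = Finsupp.single (m, k - 1) (c * (Real.sqrt k : ℝ)) := by
  simp [annihB, Finsupp.linearCombination_single]

theorem creatB_single (m k : ℕ) (c : ℂ) :
    creatB (Finsupp.single (m, k) c) =
      Finsupp.single (m, k + 1) (c * (Real.sqrt ((k : ℝ) + 1) : ℝ)) := by
  simp [creatB, Finsupp.linearCombination_single]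

theorem inner_creatA_left (v w : FockCore) :
    inner ℂ (toTwoMode (creatA v)) (toTwoMode w) =
      inner ℂ (toTwoMode v) (toTwoMode (annihA w)) := by
  refine inner_toTwoMode_eq_of_single ?_ v w
  rintro ⟨m, k⟩ ⟨m', k'⟩
  rw [creatA_single, annihA_single]
  -- At `m' = 0` the truncated index `m' - 1` is harmless, since its coefficient is `√0`.
  rcases m' with _ | m'
  · simp
  · simp only [Finsupp.single_apply, Prod.mk.injEq, Nat.add_sub_cancel, Nat.add_right_cancel_iff,
      @eq_comm _ m', @eq_comm _ k']
    split_ifs with h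
    · simp [h]
    · simp

theorem inner_creatB_left (v w : FockCore) :
    inner ℂ (toTwoMode (creatB v)) (toTwoMode w) =
      inner ℂ (toTwoMode v) (toTwoMode (annihB w)) := by
  refine inner_toTwoMode_eq_of_single ?_ v w
  rintro ⟨m, k⟩ ⟨m', k'⟩
  rw [creatB_single, annihB_single]
  rcases k' with _ | k'
  · simp
  · simp only [Finsupp.single_apply, Prod.mk.injEq, Nat.add_sub_cancel, Nat.add_right_cancel_iff,
      @eq_comm _ m', @eq_comm _ k']
    split_ifs with h
    · simp [h]
    · simp

theorem inner_annihA_left (v w : FockCore) :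
    inner ℂ (toTwoMode (annihA v)) (toTwoMode w) =
      inner ℂ (toTwoMode v) (toTwoMode (creatA w)) := by
  rw [← inner_conj_symm, ← inner_creatA_left, inner_conj_symm]

theorem inner_annihB_left (v w : FockCore) :
    inner ℂ (toTwoMode (annihB v)) (toTwoMode w) =
      inner ℂ (toTwoMode v) (toTwoMode (creatB w)) := by
  rw [← inner_conj_symm, ← inner_creatB_left, inner_conj_symm]

/-- Taking adjoints reverses products; this commutation of different modes restores the order when
proving that the beam-splitter generator is symmetric. -/
theorem creatA_annihB (v : FockCore) : creatA (annihB v) = annihB (creatA v) := by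
  induction v using Finsupp.induction_linear with
  | zero => simp
  | add v w hv hw => simp only [map_add, hv, hw]
  | single p c =>
    obtain ⟨m, k⟩ := p
    simp only [annihB_single, creatA_single]
    congr 1
    ring

theorem numberA_single (p : ℕ × ℕ) (c : ℂ) :
    (creatA ∘ₗ annihA) (Finsupp.single p c) = ((p.1 : ℝ) : ℂ) • Finsupp.single p c := by
  obtain ⟨m, k⟩ := p
  rw [LinearMap.comp_apply, annihA_single, creatA_single]
  rcases m with _ | m
  · simp
  · rw [Finsupp.smul_single, Nat.add_sub_cancel]
    congr 1
    have h : ((Real.sqrt ((m : ℝ) + 1) : ℝ) : ℂ) * (Real.sqrt ((m : ℝ) + 1) : ℝ) = (m : ℂ) + 1 := by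
      rw [← Complex.ofReal_mul, Real.mul_self_sqrt (by positivity)]
      simp
    push_cast
    rw [mul_assoc, h, smul_eq_mul, mul_comm]

theorem numberB_single (p : ℕ × ℕ) (c : ℂ) :
    (creatB ∘ₗ annihB) (Finsupp.single p c) = ((p.2 : ℝ) : ℂ) • Finsupp.single p c := by
  obtain ⟨m, k⟩ := p
  rw [LinearMap.comp_apply, annihB_single, creatB_single]
  rcases k with _ | k
  · simp
  · rw [Finsupp.smul_single, Nat.add_sub_cancel]
    congr 1
    have h : ((Real.sqrt ((k : ℝ) + 1) : ℝ) : ℂ) * (Real.sqrt ((k : ℝ) + 1) : ℝ) = (k : ℂ) + 1 := by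
      rw [← Complex.ofReal_mul, Real.mul_self_sqrt (by positivity)]
      simp
    push_cast
    rw [mul_assoc, h, smul_eq_mul, mul_comm]

theorem span_eigenvectors_eq_top_of_single {H : FockCore →ₗ[ℂ] FockCore}
    (h : ∀ p c, ∃ μ : ℝ, H (Finsupp.single p c) = (μ : ℂ) • Finsupp.single p c) :
    Submodule.span ℂ {v | ∃ μ : ℝ, H v = (μ : ℂ) • v} = ⊤ := by
  refine Submodule.eq_top_iff'.mpr fun v => ?_
  induction v using Finsupp.induction_linear with
  | zero => exact zero_mem _
  | add v w hv hw => exact add_mem hv hw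
  | single p c => exact Submodule.subset_span (h p c)

theorem UA_single (φ : ℝ) (p : ℕ × ℕ) (c : ℂ) :
    UA φ (toTwoMode (Finsupp.single p c)) =
      toTwoMode (Finsupp.single p (Complex.exp (Complex.I * φ * p.1) * c)) := by
  rw [UA, opExp_apply_eigenvector _ _ φ (numberA_single p c)]
  · simp [← map_smul]
  · intro v w
    simp only [LinearMap.comp_apply, inner_creatA_left, inner_annihA_left]
  · exact span_eigenvectors_eq_top_of_single fun p c => ⟨_, numberA_single p c⟩

theorem UB_single (θ : ℝ) (p : ℕ × ℕ) (c : ℂ) :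
    UB θ (toTwoMode (Finsupp.single p c)) =
      toTwoMode (Finsupp.single p (Complex.exp (Complex.I * θ * p.2) * c)) := by
  rw [UB, opExp_apply_eigenvector _ _ θ (numberB_single p c)]
  · simp [← map_smul]
  · intro v w
    simp only [LinearMap.comp_apply, inner_creatB_left, inner_annihB_left]
  · exact span_eigenvectors_eq_top_of_single fun p c => ⟨_, numberB_single p c⟩

/-! ### The polynomial model and the beam splitter -/

open MvPolynomial in
/-- The Segal–Bargmann correspondence: `xᵐ yᵏ` is sent to `√(m! k!) |m, k⟩`. -/
noncomputable def ofPoly : MvPolynomial (Fin 2) ℂ →ₗ[ℂ] FockCore :=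
  (basisMonomials (Fin 2) ℂ).constr ℂ fun s =>
    Finsupp.single (s 0, s 1)
      ((Real.sqrt ((Nat.factorial (s 0) : ℝ) * (Nat.factorial (s 1) : ℝ)) : ℝ) : ℂ)

theorem monomial_eq_X_pow_mul (s : Fin 2 →₀ ℕ) :
    MvPolynomial.monomial s (1 : ℂ) =
      MvPolynomial.X 0 ^ s 0 * MvPolynomial.X 1 ^ s 1 := by
  rw [MvPolynomial.monomial_eq, Finsupp.prod_fintype _ _ (by simp)]
  simp [Fin.prod_univ_two]

theorem ofPoly_X_pow_mul (m k : ℕ) :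
    ofPoly (MvPolynomial.X 0 ^ m * MvPolynomial.X 1 ^ k) =
      Finsupp.single (m, k)
        ((Real.sqrt ((Nat.factorial m : ℝ) * (Nat.factorial k : ℝ)) : ℝ) : ℂ) := by
  have h := monomial_eq_X_pow_mul (Finsupp.single 0 m + Finsupp.single 1 k)
  have h' := (MvPolynomial.basisMonomials (Fin 2) ℂ).constr_basis ℂ (fun s : Fin 2 →₀ ℕ =>
    (Finsupp.single (s 0, s 1)
      ((Real.sqrt ((Nat.factorial (s 0) : ℝ) * (Nat.factorial (s 1) : ℝ)) : ℝ) : ℂ) : FockCore))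
    (Finsupp.single 0 m + Finsupp.single 1 k)
  have e₀ : (Finsupp.single 0 m + Finsupp.single 1 k : Fin 2 →₀ ℕ) 0 = m := by simp
  have e₁ : (Finsupp.single 0 m + Finsupp.single 1 k : Fin 2 →₀ ℕ) 1 = k := by simp
  simp only [MvPolynomial.coe_basisMonomials, h, e₀, e₁] at h'
  exact h'

theorem linearMap_ext_X_pow_mul {M : Type*} [AddCommMonoid M] [Module ℂ M]
    {f g : MvPolynomial (Fin 2) ℂ →ₗ[ℂ] M}
    (h : ∀ m k : ℕ, f (MvPolynomial.X 0 ^ m * MvPolynomial.X 1 ^ k) =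
      g (MvPolynomial.X 0 ^ m * MvPolynomial.X 1 ^ k)) : f = g := by
  refine (MvPolynomial.basisMonomials (Fin 2) ℂ).ext fun s => ?_
  simpa only [MvPolynomial.coe_basisMonomials, monomial_eq_X_pow_mul] using h _ _

theorem ofPoly_surjective : Function.Surjective ofPoly := by
  rw [← LinearMap.range_eq_top, Submodule.eq_top_iff']
  intro v
  induction v using Finsupp.induction_linear with
  | zero => exact zero_mem _
  | add v w hv hw => exact add_mem hv hw
  | single p c =>
    refine ⟨(c / (Real.sqrt ((Nat.factorial p.1 : ℝ) * (Nat.factorial p.2 : ℝ)) : ℝ)) •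
      (MvPolynomial.X 0 ^ p.1 * MvPolynomial.X 1 ^ p.2), ?_⟩
    rw [map_smul, ofPoly_X_pow_mul, Finsupp.smul_single, smul_eq_mul, div_mul_cancel₀]
    rw [Complex.ofReal_ne_zero]
    positivity

/-- The derivation `x ∂/∂y + y ∂/∂x`, which represents `a†b + ab†`. -/
noncomputable def mixing : Derivation ℂ (MvPolynomial (Fin 2) ℂ) (MvPolynomial (Fin 2) ℂ) :=
  MvPolynomial.mkDerivation ℂ ![MvPolynomial.X 1, MvPolynomial.X 0]

/-- The generator `a†b + ab†` of the beam splitter. -/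
noncomputable def hopping : FockCore →ₗ[ℂ] FockCore := creatA ∘ₗ annihB + annihA ∘ₗ creatB

theorem mixing_X_zero : mixing (MvPolynomial.X 0) = MvPolynomial.X 1 := by
  simp [mixing, MvPolynomial.mkDerivation_X]

theorem mixing_X_one : mixing (MvPolynomial.X 1) = MvPolynomial.X 0 := by
  simp [mixing, MvPolynomial.mkDerivation_X]

theorem sqrt_factorial_mul (m k : ℕ) :
    Real.sqrt ((Nat.factorial m : ℝ) * (Nat.factorial (k + 1) : ℝ)) *
        (Real.sqrt ((k : ℝ) + 1) * Real.sqrt ((m : ℝ) + 1)) =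
      ((k : ℝ) + 1) * Real.sqrt ((Nat.factorial (m + 1) : ℝ) * (Nat.factorial k : ℝ)) := by
  rw [← Real.sqrt_mul (by positivity), ← Real.sqrt_mul (by positivity),
    Real.sqrt_eq_iff_mul_self_eq (by positivity) (by positivity)]
  rw [mul_mul_mul_comm ((k : ℝ) + 1), Real.mul_self_sqrt (by positivity)]
  push_cast [Nat.factorial_succ]
  ring

theorem creatA_annihB_single_sqrt (m k : ℕ) :
    creatA (annihB (Finsupp.single (m, k)
        ((Real.sqrt ((Nat.factorial m : ℝ) * (Nat.factorial k : ℝ)) : ℝ) : ℂ))) =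
      (k : ℂ) • Finsupp.single (m + 1, k - 1)
        ((Real.sqrt ((Nat.factorial (m + 1) : ℝ) * (Nat.factorial (k - 1) : ℝ)) : ℝ) : ℂ) := by
  rw [annihB_single, creatA_single]
  rcases k with _ | k
  · simp
  · rw [Finsupp.smul_single]
    congr 1
    have h := congrArg ((↑) : ℝ → ℂ) (sqrt_factorial_mul m k)
    push_cast at h ⊢
    simpa [mul_assoc] using h

theorem annihA_creatB_single_sqrt (m k : ℕ) :
    annihA (creatB (Finsupp.single (m, k)
        ((Real.sqrt ((Nat.factorial m : ℝ) * (Nat.factorial k : ℝ)) : ℝ) : ℂ))) =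
      (m : ℂ) • Finsupp.single (m - 1, k + 1)
        ((Real.sqrt ((Nat.factorial (m - 1) : ℝ) * (Nat.factorial (k + 1) : ℝ)) : ℝ) : ℂ) := by
  rw [creatB_single, annihA_single]
  rcases m with _ | m
  · simp
  · rw [Finsupp.smul_single]
    congr 1
    have h := congrArg ((↑) : ℝ → ℂ) (sqrt_factorial_mul k m)
    rw [mul_comm (Nat.factorial k : ℝ), mul_comm (Nat.factorial (k + 1) : ℝ)] at h
    push_cast at h ⊢
    simp only [smul_eq_mul] at h ⊢
    rw [← h]
    ring

/-- On monomials the normalization `√(m! k!)` absorbs the square roots of the ladder operators, so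
`a†b` acts as `x ∂/∂y` and `ab†` as `y ∂/∂x`. -/
theorem hopping_ofPoly (p : MvPolynomial (Fin 2) ℂ) :
    hopping (ofPoly p) = ofPoly (mixing p) := by
  suffices h : hopping ∘ₗ ofPoly = ofPoly ∘ₗ (mixing : _ →ₗ[ℂ] _) from LinearMap.congr_fun h p
  refine linearMap_ext_X_pow_mul fun m k => ?_
  have hD : mixing (MvPolynomial.X 0 ^ m * MvPolynomial.X 1 ^ k) =
      (k : ℂ) • (MvPolynomial.X 0 ^ (m + 1) * MvPolynomial.X 1 ^ (k - 1)) +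
      (m : ℂ) • (MvPolynomial.X 0 ^ (m - 1) * MvPolynomial.X 1 ^ (k + 1)) := by
    rw [Derivation.leibniz, Derivation.leibniz_pow, Derivation.leibniz_pow, mixing_X_zero,
      mixing_X_one]
    simp only [smul_eq_mul, nsmul_eq_mul, MvPolynomial.smul_eq_C_mul, map_natCast]
    ring
  simp only [LinearMap.comp_apply, Derivation.coeFn_coe, hD, map_add, map_smul, ofPoly_X_pow_mul]
  rw [hopping, LinearMap.add_apply, LinearMap.comp_apply, LinearMap.comp_apply,
    creatA_annihB_single_sqrt, annihA_creatB_single_sqrt]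

/-- The products `(x + y)ⁱ (x - y)ʲ` diagonalize `mixing`. -/
theorem mixing_add_pow_mul_sub_pow (i j : ℕ) :
    mixing ((MvPolynomial.X 0 + MvPolynomial.X 1) ^ i *
        (MvPolynomial.X 0 - MvPolynomial.X 1) ^ j) =
      (((i : ℝ) - (j : ℝ) : ℝ) : ℂ) • ((MvPolynomial.X 0 + MvPolynomial.X 1) ^ i *
        (MvPolynomial.X 0 - MvPolynomial.X 1) ^ j) := by
  rw [Derivation.leibniz, Derivation.leibniz_pow, Derivation.leibniz_pow, map_add, map_sub,
    mixing_X_zero, mixing_X_one]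
  simp only [smul_eq_mul, nsmul_eq_mul, MvPolynomial.smul_eq_C_mul, Complex.ofReal_sub,
    Complex.ofReal_natCast, map_sub, map_natCast]
  rcases i with _ | i <;> rcases j with _ | j <;>
    simp only [Nat.add_sub_cancel, pow_succ, pow_zero, Nat.cast_zero, Nat.cast_add, Nat.cast_one] <;>
    ring

/-- The span contains `1` and is stable under multiplication by `x + y` and `x - y`, hence by `x`
and `y`, their half sum and half difference. -/
theorem span_add_pow_mul_sub_pow :
    Submodule.span ℂ (Set.range fun q : ℕ × ℕ =>
      ((MvPolynomial.X 0 + MvPolynomial.X 1) ^ q.1 *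
        (MvPolynomial.X 0 - MvPolynomial.X 1) ^ q.2 : MvPolynomial (Fin 2) ℂ)) = ⊤ := by
  set S := Submodule.span ℂ (Set.range fun q : ℕ × ℕ =>
      ((MvPolynomial.X 0 + MvPolynomial.X 1) ^ q.1 *
        (MvPolynomial.X 0 - MvPolynomial.X 1) ^ q.2 : MvPolynomial (Fin 2) ℂ)) with hS
  have hadd (p) (hp : p ∈ S) : p * (MvPolynomial.X 0 + MvPolynomial.X 1) ∈ S := by
    induction hp using Submodule.span_induction with
    | mem p hp =>
      obtain ⟨q, rfl⟩ := hp
      exact Submodule.subset_span ⟨(q.1 + 1, q.2), by dsimp only; ring⟩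
    | zero => simp
    | add p q _ _ hp hq => rw [add_mul]; exact add_mem hp hq
    | smul a p _ hp => rw [smul_mul_assoc]; exact S.smul_mem a hp
  have hsub (p) (hp : p ∈ S) : p * (MvPolynomial.X 0 - MvPolynomial.X 1) ∈ S := by
    induction hp using Submodule.span_induction with
    | mem p hp =>
      obtain ⟨q, rfl⟩ := hp
      exact Submodule.subset_span ⟨(q.1, q.2 + 1), by dsimp only; ring⟩
    | zero => simp
    | add p q _ _ hp hq => rw [add_mul]; exact add_mem hp hq
    | smul a p _ hp => rw [smul_mul_assoc]; exact S.smul_mem a hp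
  have hC : (MvPolynomial.C (1 / 2) * 2 : MvPolynomial (Fin 2) ℂ) = 1 := by
    rw [show (2 : MvPolynomial (Fin 2) ℂ) = MvPolynomial.C 2 from
      (map_ofNat MvPolynomial.C 2).symm, ← MvPolynomial.C_mul]
    norm_num
  refine Submodule.eq_top_iff'.mpr fun p => ?_
  induction p using MvPolynomial.induction_on with
  | C a =>
    have : (1 : MvPolynomial (Fin 2) ℂ) ∈ S := Submodule.subset_span ⟨(0, 0), by simp⟩
    rw [show MvPolynomial.C a = a • (1 : MvPolynomial (Fin 2) ℂ) by simp [MvPolynomial.smul_eq_C_mul]]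
    exact S.smul_mem a this
  | add p q hp hq => exact add_mem hp hq
  | mul_X p i hp =>
    obtain rfl | rfl : i = 0 ∨ i = 1 := by fin_cases i <;> simp
    · have h := S.smul_mem (1 / 2 : ℂ) (add_mem (hadd p hp) (hsub p hp))
      rw [MvPolynomial.smul_eq_C_mul] at h
      convert h using 1
      linear_combination (-(p * MvPolynomial.X 0)) * hC
    · have h := S.smul_mem (1 / 2 : ℂ) (sub_mem (hadd p hp) (hsub p hp))
      rw [MvPolynomial.smul_eq_C_mul] at h
      convert h using 1
      linear_combination (-(p * MvPolynomial.X 1)) * hC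

theorem hopping_eigenvector (i j : ℕ) :
    hopping (ofPoly ((MvPolynomial.X 0 + MvPolynomial.X 1) ^ i *
        (MvPolynomial.X 0 - MvPolynomial.X 1) ^ j)) =
      (((i : ℝ) - (j : ℝ) : ℝ) : ℂ) • ofPoly ((MvPolynomial.X 0 + MvPolynomial.X 1) ^ i *
        (MvPolynomial.X 0 - MvPolynomial.X 1) ^ j) := by
  rw [hopping_ofPoly, mixing_add_pow_mul_sub_pow, map_smul]

theorem inner_hopping_left (v w : FockCore) :
    inner ℂ (toTwoMode (hopping v)) (toTwoMode w) =
      inner ℂ (toTwoMode v) (toTwoMode (hopping w)) := by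
  simp only [hopping, LinearMap.add_apply, LinearMap.comp_apply, map_add, inner_add_left,
    inner_add_right, inner_creatA_left, inner_annihA_left, inner_creatB_left, inner_annihB_left,
    creatA_annihB]
  exact add_comm _ _

theorem span_hopping_eigenvectors :
    Submodule.span ℂ {v | ∃ μ : ℝ, hopping v = (μ : ℂ) • v} = ⊤ := by
  rw [eq_top_iff, ← LinearMap.range_eq_top.mpr ofPoly_surjective, ← Submodule.map_top,
    ← span_add_pow_mul_sub_pow, Submodule.map_span]
  refine Submodule.span_mono ?_
  rintro _ ⟨_, ⟨q, rfl⟩, rfl⟩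
  exact ⟨_, hopping_eigenvector q.1 q.2⟩

/-- The rotation of the two variables implemented by the beam splitter. -/
noncomputable def rotation (κ : ℝ) : MvPolynomial (Fin 2) ℂ →ₐ[ℂ] MvPolynomial (Fin 2) ℂ :=
  MvPolynomial.aeval
    ![(Real.cos κ : ℂ) • MvPolynomial.X 0 + (Complex.I * Real.sin κ) • MvPolynomial.X 1,
      (Complex.I * Real.sin κ) • MvPolynomial.X 0 + (Real.cos κ : ℂ) • MvPolynomial.X 1]

theorem rotation_X_zero (κ : ℝ) : rotation κ (MvPolynomial.X 0) =
    (Real.cos κ : ℂ) • MvPolynomial.X 0 + (Complex.I * Real.sin κ) • MvPolynomial.X 1 := by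
  simp [rotation]

theorem rotation_X_one (κ : ℝ) : rotation κ (MvPolynomial.X 1) =
    (Complex.I * Real.sin κ) • MvPolynomial.X 0 + (Real.cos κ : ℂ) • MvPolynomial.X 1 := by
  simp [rotation]

theorem rotation_add (κ : ℝ) : rotation κ (MvPolynomial.X 0 + MvPolynomial.X 1) =
    Complex.exp (Complex.I * κ) • (MvPolynomial.X 0 + MvPolynomial.X 1) := by
  rw [map_add, rotation_X_zero, rotation_X_one, mul_comm Complex.I (κ : ℂ), Complex.exp_mul_I,
    ← Complex.ofReal_cos, ← Complex.ofReal_sin]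
  module

theorem rotation_sub (κ : ℝ) : rotation κ (MvPolynomial.X 0 - MvPolynomial.X 1) =
    Complex.exp (-(Complex.I * κ)) • (MvPolynomial.X 0 - MvPolynomial.X 1) := by
  rw [map_sub, rotation_X_zero, rotation_X_one,
    show -(Complex.I * (κ : ℂ)) = ((-κ : ℝ) : ℂ) * Complex.I by push_cast; ring, Complex.exp_mul_I,
    ← Complex.ofReal_cos, ← Complex.ofReal_sin, Real.cos_neg, Real.sin_neg]
  push_cast
  module

/-- By linearity it suffices to test `(x+y)ⁱ (x-y)ʲ`, which both sides multiply by `e^{iκ(i-j)}`. -/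
theorem UAB_ofPoly (κ : ℝ) (p : MvPolynomial (Fin 2) ℂ) :
    UAB κ (toTwoMode (ofPoly p)) = toTwoMode (ofPoly (rotation κ p)) := by
  have hp : p ∈ Submodule.span ℂ (Set.range fun q : ℕ × ℕ =>
      ((MvPolynomial.X 0 + MvPolynomial.X 1) ^ q.1 *
        (MvPolynomial.X 0 - MvPolynomial.X 1) ^ q.2 : MvPolynomial (Fin 2) ℂ)) :=
    span_add_pow_mul_sub_pow ▸ Submodule.mem_top
  induction hp using Submodule.span_induction with
  | mem p hp =>
    obtain ⟨⟨i, j⟩, rfl⟩ := hp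
    have h := opExp_apply_eigenvector inner_hopping_left span_hopping_eigenvectors κ
      (hopping_eigenvector i j)
    rw [UAB, ← hopping, h]
    simp only [map_mul, map_pow, rotation_add, rotation_sub, smul_pow, smul_mul_smul_comm,
      ← Complex.exp_nat_mul, ← Complex.exp_add, map_smul]
    congr 2
    push_cast
    ring
  | zero => simp
  | add p q _ _ hp hq => simp only [map_add, hp, hq]
  | smul a p _ hp => simp only [map_smul, hp]

/-! ### Binomial splitting of Fock states -/

/-- The amplitude of `|k, l - k⟩` in the image of `|l, 0⟩` under the beam splitter. -/
noncomputable def splitAmplitude (κ : ℝ) (l k : ℕ) : ℂ :=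
  ((Real.cos κ : ℂ) ^ k * (Complex.I * Real.sin κ) ^ (l - k) * (l.choose k : ℂ)) *
    ((Real.sqrt ((Nat.factorial k : ℝ) * (Nat.factorial (l - k) : ℝ)) : ℝ) : ℂ) /
      ((Real.sqrt (Nat.factorial l : ℝ) : ℝ) : ℂ)

theorem UAB_single_zero (κ : ℝ) (l : ℕ) :
    UAB κ (toTwoMode (Finsupp.single (l, 0) 1)) =
      toTwoMode (∑ k ∈ Finset.range (l + 1),
        Finsupp.single (k, l - k) (splitAmplitude κ l k)) := by
  have h0 : ((Real.sqrt (Nat.factorial l : ℝ) : ℝ) : ℂ) ≠ 0 := by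
    rw [Complex.ofReal_ne_zero]
    positivity
  have h1 : (Finsupp.single (l, 0) 1 : FockCore) =
      ((Real.sqrt (Nat.factorial l : ℝ) : ℝ) : ℂ)⁻¹ • ofPoly (MvPolynomial.X 0 ^ l) := by
    have h := ofPoly_X_pow_mul l 0
    rw [pow_zero, mul_one] at h
    rw [h, Finsupp.smul_single, Nat.factorial_zero, Nat.cast_one, mul_one, smul_eq_mul,
      inv_mul_cancel₀ h0]
  rw [h1, map_smul, map_smul, UAB_ofPoly, map_pow, rotation_X_zero, add_pow, map_sum, map_sum,
    map_sum, Finset.smul_sum]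
  refine Finset.sum_congr rfl fun k _ => ?_
  have h2 : ((Real.cos κ : ℂ) • (MvPolynomial.X 0 : MvPolynomial (Fin 2) ℂ)) ^ k *
      ((Complex.I * Real.sin κ) • MvPolynomial.X 1) ^ (l - k) *
        ((l.choose k : ℕ) : MvPolynomial (Fin 2) ℂ) =
      ((Real.cos κ : ℂ) ^ k * (Complex.I * Real.sin κ) ^ (l - k) * (l.choose k : ℂ)) •
        (MvPolynomial.X 0 ^ k * MvPolynomial.X 1 ^ (l - k)) := by
    simp only [MvPolynomial.smul_eq_C_mul, mul_pow, map_mul, map_pow, map_natCast]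
    ring
  rw [h2, map_smul, ofPoly_X_pow_mul, ← map_smul, Finsupp.smul_single, Finsupp.smul_single,
    splitAmplitude, smul_eq_mul, smul_eq_mul, div_eq_inv_mul]

theorem conj_splitAmplitude_mul_self {κ : ℝ} {l k : ℕ} (hk : k ≤ l) :
    (starRingEnd ℂ) (splitAmplitude κ l k) * splitAmplitude κ l k =
      ((efficiency κ) ^ k * (1 - efficiency κ) ^ (l - k) * (l.choose k : ℝ) : ℝ) := by
  have hc : ((l.choose k : ℝ) * ((Nat.factorial k : ℝ) * (Nat.factorial (l - k) : ℝ))) =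
      Nat.factorial l := by
    rw [← mul_assoc]
    exact_mod_cast Nat.choose_mul_factorial_mul_factorial hk
  have hl : (Nat.factorial l : ℝ) ≠ 0 := by positivity
  have hs : 1 - efficiency κ = Real.sin κ ^ 2 := by
    rw [efficiency, Real.sin_sq]
  rw [← Complex.normSq_eq_conj_mul_self]
  congr 1
  rw [splitAmplitude, hs, efficiency]
  simp only [map_mul, map_div₀, map_pow, Complex.normSq_I, Complex.normSq_ofReal,
    Complex.normSq_natCast, one_mul]
  rw [Real.mul_self_sqrt (by positivity), Real.mul_self_sqrt (by positivity), div_eq_iff hl, ← hc]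
  ring

/-! ### The fidelity amplitude as a power series in `z` -/

/-- The operator whose expectation value in `|Ψ⟩` is the fidelity amplitude. -/
noncomputable def echo (κ φ θ : ℝ) : TwoMode →L[ℂ] TwoMode :=
  ContinuousLinearMap.adjoint (UAB κ) ∘L ContinuousLinearMap.adjoint (UB θ) ∘L UA φ ∘L UAB κ

theorem inner_echo (κ φ θ : ℝ) (f g : TwoMode) :
    inner ℂ f (echo κ φ θ g) = inner ℂ (UB θ (UAB κ f)) (UA φ (UAB κ g)) := by
  simp only [echo, ContinuousLinearMap.comp_apply, ContinuousLinearMap.adjoint_inner_right]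

theorem inner_echo_single_zero (κ φ θ : ℝ) (m l : ℕ) :
    inner ℂ (toTwoMode (Finsupp.single (m, 0) 1))
      (echo κ φ θ (toTwoMode (Finsupp.single (l, 0) 1))) =
      if m = l then zParam (efficiency κ) φ θ ^ l else 0 := by
  rw [inner_echo, UAB_single_zero, UAB_single_zero]
  simp only [map_sum, UA_single, UB_single, sum_inner, inner_sum, inner_toTwoMode_single_left,
    toTwoMode_apply, Finsupp.single_apply, Prod.mk.injEq]
  split_ifs with h
  · subst h
    rw [zParam, add_pow]
    refine Finset.sum_congr rfl fun k hk => ?_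
    rw [Finset.sum_eq_single k]
    · have hk' : k ≤ m := Nat.lt_succ_iff.mp (Finset.mem_range.mp hk)
      have h := conj_splitAmplitude_mul_self (κ := κ) hk'
      rw [if_pos ⟨rfl, rfl⟩, map_mul, ← Complex.exp_conj]
      simp only [map_mul, Complex.conj_I, Complex.conj_ofReal, map_natCast]
      rw [mul_mul_mul_comm, h, mul_pow, mul_pow, ← Complex.exp_nat_mul, ← Complex.exp_nat_mul]
      push_cast
      rw [show -Complex.I * (θ : ℂ) * ((m - k : ℕ) : ℂ) = ((m - k : ℕ) : ℂ) * -(Complex.I * θ) by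
          ring, show Complex.I * (φ : ℂ) * (k : ℂ) = (k : ℂ) * (Complex.I * φ) by ring]
      ring
    · intro j _ hj
      rw [if_neg fun h => hj h.1.symm, mul_zero]
    · exact fun h => absurd hk h
  -- The two images have total photon numbers `m ≠ l`, so they share no Fock state.
  · refine Finset.sum_eq_zero fun j hj => Finset.sum_eq_zero fun k hk => ?_
    rw [if_neg, mul_zero]
    rw [Finset.mem_range] at hj hk
    omega

theorem hasSum_withVacuum (ψ : Mode) :
    HasSum (fun l : ℕ => ψ l • toTwoMode (Finsupp.single (l, 0) 1)) (withVacuum ψ) := by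
  have h : HasSum (fun p : ℕ × ℕ => (lp.single 2 p (withVacuum ψ p) : TwoMode)) (withVacuum ψ) :=
    lp.hasSum_single (by norm_num) _
  have hinj : Function.Injective (fun n : ℕ => ((n, 0) : ℕ × ℕ)) := fun m n h => by
    simpa using h
  rw [← hinj.hasSum_iff] at h
  · refine h.congr_fun ?_
    intro l
    rw [← map_smul, Finsupp.smul_single, toTwoMode_single]
    simp [withVacuum]
  · rintro ⟨m, k⟩ hmk
    have hk : k ≠ 0 := fun hk => hmk ⟨m, by simp [hk]⟩
    simp [withVacuum, hk]

theorem echo_withVacuum_apply (κ φ θ : ℝ) (ψ : Mode) (m : ℕ) :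
    echo κ φ θ (withVacuum ψ) (m, 0) = zParam (efficiency κ) φ θ ^ m * ψ m := by
  have h := ((hasSum_withVacuum ψ).mapL (echo κ φ θ)).mapL
    (innerSL ℂ (toTwoMode (Finsupp.single (m, 0) 1)))
  simp only [map_smul, innerSL_apply_apply, inner_echo_single_zero] at h
  have h' := h.unique (hasSum_single m fun l hl => by simp [hl.symm])
  rw [inner_toTwoMode_single_left] at h'
  simpa [mul_comm] using h'

/-- The left vector lives on the vacuum of `B`, so only the amplitudes at `(m, 0)` contribute. -/
theorem hasSum_inner_echo (κ φ θ : ℝ) (ψ : Mode) :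
    HasSum (fun m : ℕ => zParam (efficiency κ) φ θ ^ m * ((‖ψ m‖ ^ 2 : ℝ) : ℂ))
      (inner ℂ (withVacuum ψ) (echo κ φ θ (withVacuum ψ))) := by
  have h := lp.hasSum_inner (𝕜 := ℂ) (G := fun _ : ℕ × ℕ => ℂ) (withVacuum ψ) (echo κ φ θ (withVacuum ψ))
  have hinj : Function.Injective (fun n : ℕ => ((n, 0) : ℕ × ℕ)) := fun m n h => by
    simpa using h
  rw [← hinj.hasSum_iff] at h
  · refine h.congr_fun ?_
    intro m
    have e : withVacuum ψ (m, 0) = ψ m := by simp [withVacuum]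
    simp only [Function.comp_apply, echo_withVacuum_apply, e, RCLike.inner_apply]
    rw [mul_assoc, Complex.mul_conj, Complex.normSq_eq_norm_sq]
  · rintro ⟨m, k⟩ hmk
    have hk : k ≠ 0 := fun hk => hmk ⟨m, by simp [hk]⟩
    have e : withVacuum ψ (m, k) = 0 := by simp [withVacuum, hk]
    rw [e, inner_zero_left]

/-! ### Jensen's inequality and the bound -/

/-- Jensen's inequality for the convex function `x ↦ zˣ` and a distribution on `ℕ`. -/
theorem rpow_mean_le_of_hasSum {p : ℕ → ℝ} (hp : ∀ m, 0 ≤ p m) (hp1 : HasSum p 1)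
    {μ : ℝ} (hμ : HasSum (fun m : ℕ => (m : ℝ) * p m) μ) {z : ℝ} (hz : 0 < z) {S : ℝ}
    (hS : HasSum (fun m : ℕ => z ^ m * p m) S) : z ^ μ ≤ S := by
  -- The tangent line to `x ↦ zˣ` at the mean `μ`; its linear term averages to zero.
  have h : HasSum (fun m : ℕ => z ^ μ * ((1 + ((m : ℝ) - μ) * Real.log z) * p m))
      (z ^ μ * (1 + (μ - μ * 1) * Real.log z)) := by
    refine HasSum.mul_left _ ?_
    refine (hp1.add ((hμ.sub (hp1.mul_left μ)).mul_right (Real.log z))).congr_fun ?_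
    intro m
    ring
  rw [mul_one, sub_self, zero_mul, add_zero, mul_one] at h
  refine hasSum_le (fun m => ?_) h hS
  rw [← mul_assoc]
  refine mul_le_mul_of_nonneg_right ?_ (hp m)
  have e : z ^ m = z ^ μ * Real.exp (((m : ℝ) - μ) * Real.log z) := by
    rw [mul_comm _ (Real.log z), ← Real.rpow_def_of_pos hz, ← Real.rpow_add hz,
      add_sub_cancel, Real.rpow_natCast]
  rw [e]
  refine mul_le_mul_of_nonneg_left ?_ (Real.rpow_nonneg hz.le _)
  rw [add_comm]
  exact Real.add_one_le_exp _

theorem rpow_le_fidelity {κ φ θ z : ℝ} (hz : 0 < z)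
    (h : zParam (efficiency κ) φ θ = (z : ℂ)) {ψ : Mode} (hψ : ‖ψ‖ = 1)
    (hmean : HasFiniteMean ψ) : z ^ (2 * meanPhoton ψ) ≤ fidelity κ φ θ ψ := by
  have hs := hasSum_inner_echo κ φ θ ψ
  rw [h] at hs
  have hre := Complex.hasSum_re hs
  have hp1 : HasSum (fun m : ℕ => ‖ψ m‖ ^ 2) 1 := by
    have := lp.hasSum_norm (p := 2) (by norm_num) ψ
    simpa [hψ] using this
  have hJ := rpow_mean_le_of_hasSum (fun m => sq_nonneg ‖ψ m‖) hp1 hmean.hasSum hz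
    (hre.congr_fun fun m => by
      rw [← Complex.ofReal_pow, ← Complex.ofReal_mul, Complex.ofReal_re])
  rw [mul_comm, Real.rpow_mul hz.le, Real.rpow_two]
  change _ ≤ ‖inner ℂ (withVacuum ψ) (echo κ φ θ (withVacuum ψ))‖ ^ 2
  exact pow_le_pow_left₀ (Real.rpow_nonneg hz.le _)
    (hJ.trans ((le_abs_self _).trans (Complex.abs_re_le_norm _))) 2

/-! ### Existence of a suitable `θ` -/

theorem zParam_eq (η φ θ : ℝ) : zParam η φ θ =
    ((η * Real.cos φ + (1 - η) * Real.cos θ : ℝ) : ℂ) +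
      ((η * Real.sin φ - (1 - η) * Real.sin θ : ℝ) : ℂ) * Complex.I := by
  rw [zParam, show -(Complex.I * (θ : ℂ)) = ((-θ : ℝ) : ℂ) * Complex.I by push_cast; ring,
    mul_comm Complex.I, Complex.exp_mul_I, Complex.exp_mul_I, ← Complex.ofReal_cos,
    ← Complex.ofReal_sin, ← Complex.ofReal_cos, ← Complex.ofReal_sin, Real.cos_neg, Real.sin_neg]
  push_cast
  ring

/-- Both cases give `|η sin φ| ≤ 1 - η`, so `(1 - η) sin θ = η sin φ` is solvable with `cos θ ≥ 0`,
which cancels the imaginary part. -/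
theorem exists_zParam_pos {η φ : ℝ} (h0 : 0 ≤ η) (h1 : η ≤ 1)
    (h : η < 1 / 2 ∨ (1 / 2 ≤ η ∧ |Real.sin φ| ≤ (1 - η) / η ∧ 0 < Real.cos φ)) :
    ∃ θ z : ℝ, 0 < z ∧ zParam η φ θ = (z : ℂ) := by
  have hsin : |η * Real.sin φ| ≤ 1 - η := by
    rw [abs_mul, abs_of_nonneg h0]
    rcases h with h | ⟨h, hs, -⟩
    · nlinarith [Real.abs_sin_le_one φ, abs_nonneg (Real.sin φ)]
    · rw [le_div_iff₀ (by linarith)] at hs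
      linarith
  have hratio : |η * Real.sin φ / (1 - η)| ≤ 1 := by
    rw [abs_div, abs_of_nonneg (sub_nonneg.mpr h1)]
    exact div_le_one_of_le₀ hsin (sub_nonneg.mpr h1)
  set θ := Real.arcsin (η * Real.sin φ / (1 - η)) with hθ
  have hcos : 0 ≤ Real.cos θ := Real.cos_arcsin_nonneg _
  have him : (1 - η) * Real.sin θ = η * Real.sin φ := by
    rw [hθ, Real.sin_arcsin (abs_le.mp hratio).1 (abs_le.mp hratio).2]
    -- If `η = 1` the quotient is the default `0`, but then `hsin` forces `η sin φ = 0`.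
    refine mul_div_cancel_of_imp' fun h => ?_
    rw [h] at hsin
    exact abs_nonpos_iff.mp hsin
  refine ⟨θ, η * Real.cos φ + (1 - η) * Real.cos θ, ?_, ?_⟩
  · rcases h with h | ⟨h, -, hc⟩
    -- With equal imaginary parts the squares differ by `(1-η)² - η² = 1 - 2η > 0`, so the `θ` term
    -- dominates whatever the sign of `cos φ`.
    · have hsq : (η * Real.cos φ) ^ 2 < ((1 - η) * Real.cos θ) ^ 2 := by
        have e1 := Real.sin_sq_add_cos_sq φ
        have e2 := Real.sin_sq_add_cos_sq θ
        have e3 : ((1 - η) * Real.cos θ) ^ 2 = (η * Real.cos φ) ^ 2 + (1 - 2 * η) := by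
          linear_combination (1 - η) ^ 2 * e2 - η ^ 2 * e1 -
            ((1 - η) * Real.sin θ + η * Real.sin φ) * him
        linarith
      linarith [(abs_lt.mp (abs_lt_of_sq_lt_sq hsq (mul_nonneg (by linarith) hcos))).1]
    · have := mul_nonneg (sub_nonneg.mpr h1) hcos
      have : 0 < η * Real.cos φ := mul_pos (by linarith) hc
      linarith
  · rw [zParam_eq, him, sub_self]
    simp

end LossyPhase

theorem mainTheorem1 (κ φ : ℝ)
    (h : LossyPhase.efficiency κ < 1 / 2 ∨
      (1 / 2 ≤ LossyPhase.efficiency κ ∧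
        |Real.sin φ| ≤ (1 - LossyPhase.efficiency κ) / LossyPhase.efficiency κ ∧
        0 < Real.cos φ)) :
    (∃ θ z : ℝ, 0 < z ∧ LossyPhase.zParam (LossyPhase.efficiency κ) φ θ = (z : ℂ)) ∧
    ∀ θ z : ℝ, 0 < z → LossyPhase.zParam (LossyPhase.efficiency κ) φ θ = (z : ℂ) →
      ∀ ψ : LossyPhase.Mode, ‖ψ‖ = 1 → LossyPhase.HasFiniteMean ψ →
        z ^ (2 * LossyPhase.meanPhoton ψ) ≤ LossyPhase.fidelity κ φ θ ψ :=
  ⟨LossyPhase.exists_zParam_pos (sq_nonneg _) (Real.cos_sq_le_one κ) h,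
    fun _ _ hz hθ _ hψ hmean => LossyPhase.rpow_le_fidelity hz hθ hψ hmean⟩
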